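/- A \emph{$2$-copula} is a bivariate distribution function on $[0,1]^2$ with uniform margins, i.e. a function $C:[0,1]^2\to\mathbb{R}$ such that $C(u,0)=C(0,v)=0$, $C(u,1)=u$ and $C(1,v)=v$ for all $u,v\in[0,1]$, and $C(u_2,v_2)-C(u_2,v_1)-C(u_1,v_2)+C(u_1,v_1)\ge 0$ whenever $0\le u_1\le u_2\le 1$ and $0\le v_1\le v_2\le 1$. The \emph{Markov product} of two $2$-copulas is $$(C_1*C_2)(u,v)=\int_0^1 \partial_2 C_1(u,t)\,\partial_1 C_2(t,v)\,dt ,$$ where the partial derivatives exist for almost every $t$. A $2$-copula $C$ is \emph{idempotent} if $C*C=C$, and \emph{negative quadrant dependent} if $C(u,v)\le \Pi(u,v)$ for all $u,v\in[0,1]$, where $\Pi(u,v)=uv$ is the product copula. \textbf{Proposition.} The product copula $\Pi$ is an idempotent, negative quadrant dependent $2$-copula, and it is the only one: if $C$ is a $2$-copula that is idempotent and negative quadrant dependent, then $C(u,v)=uv$ for all $u,v\in[0,1]$. -/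

import Mathlib

open Set

noncomputable section

/-- `C` restricts to a 2-copula on `[0,1]²`, that is, to a bivariate distribution function with
uniform margins: it vanishes on the lower and left edges, has uniform margins, and gives
nonnegative mass to every rectangle. Only the values of `C` on `[0,1]²` matter. -/
structure IsCopula (C : ℝ → ℝ → ℝ) : Prop where
  zero_left : ∀ v ∈ Icc (0 : ℝ) 1, C 0 v = 0
  zero_right : ∀ u ∈ Icc (0 : ℝ) 1, C u 0 = 0
  one_left : ∀ v ∈ Icc (0 : ℝ) 1, C 1 v = v
  one_right : ∀ u ∈ Icc (0 : ℝ) 1, C u 1 = u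
  two_increasing : ∀ u₁ ∈ Icc (0 : ℝ) 1, ∀ u₂ ∈ Icc (0 : ℝ) 1,
    ∀ v₁ ∈ Icc (0 : ℝ) 1, ∀ v₂ ∈ Icc (0 : ℝ) 1, u₁ ≤ u₂ → v₁ ≤ v₂ →
      0 ≤ C u₂ v₂ - C u₂ v₁ - C u₁ v₂ + C u₁ v₁

/-- The product (independence) copula `Π(u,v) = uv`. -/
def productCopula (u v : ℝ) : ℝ := u * v

/-- The Markov product `(C₁ * C₂)(u,v) = ∫₀¹ ∂₂C₁(u,t) ∂₁C₂(t,v) dt`. For copulas and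
`u, v ∈ [0,1]` both partial derivatives exist for almost every `t ∈ (0,1)`, are bounded there,
and depend only on the values of `C₁`, `C₂` on `[0,1]²`. -/
def markovProduct (C₁ C₂ : ℝ → ℝ → ℝ) (u v : ℝ) : ℝ :=
  ∫ t in (0 : ℝ)..1, deriv (fun s => C₁ u s) t * deriv (fun s => C₂ s v) t

/-- `C * C = C` on `[0,1]²`. -/
def IsMarkovIdempotent (C : ℝ → ℝ → ℝ) : Prop :=
  ∀ u ∈ Icc (0 : ℝ) 1, ∀ v ∈ Icc (0 : ℝ) 1, markovProduct C C u v = C u v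

/-- Negative quadrant dependence: `C ≤ Π` on `[0,1]²`. -/
def IsNegativeQuadrantDependent (C : ℝ → ℝ → ℝ) : Prop :=
  ∀ u ∈ Icc (0 : ℝ) 1, ∀ v ∈ Icc (0 : ℝ) 1, C u v ≤ productCopula u v

end

open MeasureTheory intervalIntegral

/-! ### Sections of a copula and their derivatives -/

namespace IsCopula

variable {C : ℝ → ℝ → ℝ}

/-! A copula induces a Markov operator `T` contracting `L²(0,1)` (`integral_sq_deriv_le`, by
Jensen), and `T` sends `1_[0,v]` to `g = ∂₁C(·,v)`. Idempotence gives `T g = g`; a contractive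
projection is orthogonal, so `‖g‖² ≤ ⟨g, 1_[0,v]⟩ = C(v,v)` (`integral_sq_deriv_le_diag`). Negative
quadrant dependence bounds this by `v²`, the square of the mean of `g`. Hence `g` has zero variance,
`g = v` a.e., and integrating gives `C(u,v) = uv`. -/

theorem transpose (hC : IsCopula C) : IsCopula fun u v => C v u where
  zero_left := hC.zero_right
  zero_right := hC.zero_left
  one_left := hC.one_right
  one_right := hC.one_left
  two_increasing u₁ hu₁ u₂ hu₂ v₁ hv₁ v₂ hv₂ hu hv := by
    linarith [hC.two_increasing v₁ hv₁ v₂ hv₂ u₁ hu₁ u₂ hu₂ hv hu]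

theorem monotoneOn_sub (hC : IsCopula C) {u₁ u₂ : ℝ} (hu₁ : u₁ ∈ Icc (0 : ℝ) 1)
    (hu₂ : u₂ ∈ Icc (0 : ℝ) 1) (hu : u₁ ≤ u₂) :
    MonotoneOn (fun t => C u₂ t - C u₁ t) (Icc 0 1) := by
  intro v₁ hv₁ v₂ hv₂ hv
  have := hC.two_increasing u₁ hu₁ u₂ hu₂ v₁ hv₁ v₂ hv₂ hu hv
  dsimp only
  linarith

theorem monotoneOn (hC : IsCopula C) {u : ℝ} (hu : u ∈ Icc (0 : ℝ) 1) :
    MonotoneOn (C u) (Icc 0 1) := by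
  intro v₁ hv₁ v₂ hv₂ hv
  have h := hC.monotoneOn_sub ⟨le_rfl, zero_le_one⟩ hu hu.1 hv₁ hv₂ hv
  simpa [hC.zero_left v₁ hv₁, hC.zero_left v₂ hv₂] using h

/-- Since `C 1 - C u` is nondecreasing, `C u` grows no faster than `C 1 t = t`. -/
theorem lipschitzOnWith (hC : IsCopula C) {u : ℝ} (hu : u ∈ Icc (0 : ℝ) 1) :
    LipschitzOnWith 1 (C u) (Icc 0 1) := by
  refine LipschitzOnWith.of_le_add_mul 1 fun x hx y hy => ?_
  rw [NNReal.coe_one, one_mul, Real.dist_eq]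
  rcases le_total x y with h | h
  · linarith [hC.monotoneOn hu hx hy h, abs_nonneg (x - y)]
  · have h' := hC.monotoneOn_sub hu ⟨zero_le_one, le_rfl⟩ hu.2 hy hx h
    simp only [hC.one_left x hx, hC.one_left y hy] at h'
    linarith [le_abs_self (x - y)]

theorem absolutelyContinuousOnInterval (hC : IsCopula C) {u : ℝ} (hu : u ∈ Icc (0 : ℝ) 1) :
    AbsolutelyContinuousOnInterval (C u) 0 1 := by
  apply LipschitzOnWith.absolutelyContinuousOnInterval (K := 1)
  rw [uIcc_of_le zero_le_one]
  exact hC.lipschitzOnWith hu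

theorem integral_deriv (hC : IsCopula C) {u v : ℝ} (hu : u ∈ Icc (0 : ℝ) 1)
    (hv : v ∈ Icc (0 : ℝ) 1) : ∫ t in (0 : ℝ)..v, deriv (C u) t = C u v := by
  have h : AbsolutelyContinuousOnInterval (C u) 0 v := by
    apply (hC.absolutelyContinuousOnInterval hu).mono
    rw [uIcc_of_le zero_le_one, uIcc_of_le hv.1]
    exact Icc_subset_Icc_right hv.2
  rw [h.integral_deriv_eq_sub, hC.zero_right u hu, sub_zero]

theorem deriv_nonneg (hC : IsCopula C) {u t : ℝ} (hu : u ∈ Icc (0 : ℝ) 1)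
    (ht : t ∈ Ioo (0 : ℝ) 1) : 0 ≤ deriv (C u) t := by
  rw [← derivWithin_of_mem_nhds (Icc_mem_nhds ht.1 ht.2)]
  exact (hC.monotoneOn hu).derivWithin_nonneg

theorem deriv_le_one (hC : IsCopula C) {u t : ℝ} (hu : u ∈ Icc (0 : ℝ) 1)
    (ht : t ∈ Ioo (0 : ℝ) 1) : deriv (C u) t ≤ 1 := by
  have h := norm_deriv_le_of_lipschitzOn (Icc_mem_nhds ht.1 ht.2) (hC.lipschitzOnWith hu)
  exact (le_abs_self _).trans h

/-- Only a.e.: unlike the two bounds above, the comparison can fail where `deriv` takes its default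
value 0. -/
theorem ae_deriv_le_deriv (hC : IsCopula C) {u₁ u₂ : ℝ} (hu₁ : u₁ ∈ Icc (0 : ℝ) 1)
    (hu₂ : u₂ ∈ Icc (0 : ℝ) 1) (hu : u₁ ≤ u₂) :
    ∀ᵐ t, t ∈ Ioo (0 : ℝ) 1 → deriv (C u₁) t ≤ deriv (C u₂) t := by
  filter_upwards [(hC.absolutelyContinuousOnInterval hu₁).ae_differentiableAt,
    (hC.absolutelyContinuousOnInterval hu₂).ae_differentiableAt] with t h₁ h₂ ht
  have ht' : t ∈ uIcc (0 : ℝ) 1 := by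
    rw [uIcc_of_le zero_le_one]; exact Ioo_subset_Icc_self ht
  have h : 0 ≤ deriv (fun s => C u₂ s - C u₁ s) t := by
    rw [← derivWithin_of_mem_nhds (Icc_mem_nhds ht.1 ht.2)]
    exact (hC.monotoneOn_sub hu₁ hu₂ hu).derivWithin_nonneg
  rw [deriv_fun_sub (h₂ ht') (h₁ ht')] at h
  linarith

end IsCopula

/-! ### Integrals over the unit interval -/

theorem intervalIntegrable_zero_one_of_measurable_of_abs_le {f : ℝ → ℝ} (hf : Measurable f) (K : ℝ)
    (hK : ∀ t ∈ Ioo (0 : ℝ) 1, |f t| ≤ K) : IntervalIntegrable f volume 0 1 := by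
  rw [intervalIntegrable_iff_integrableOn_Ioo_of_le zero_le_one]
  refine IntegrableOn.of_bound (by simp) hf.aestronglyMeasurable K ?_
  exact (ae_restrict_iff' measurableSet_Ioo).2 (.of_forall hK)

theorem integral_zero_one_mono_of_ae_Ioo {f g : ℝ → ℝ} (hf : IntervalIntegrable f volume 0 1)
    (hg : IntervalIntegrable g volume 0 1) (h : ∀ᵐ t, t ∈ Ioo (0 : ℝ) 1 → f t ≤ g t) :
    ∫ t in (0 : ℝ)..1, f t ≤ ∫ t in (0 : ℝ)..1, g t := by
  apply integral_mono_ae_restrict zero_le_one hf hg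
  rw [← restrict_Ioo_eq_restrict_Icc]
  exact (ae_restrict_iff' measurableSet_Ioo).2 h

/-! ### The Markov operator and uniqueness -/

namespace IsCopula

variable {C : ℝ → ℝ → ℝ}

/-- The Markov operator `h ↦ d/du ∫₀¹ ∂₂C(u,t) h(t) dt` of a copula is an `L²` contraction. -/
theorem integral_sq_deriv_le (hC : IsCopula C) {F h : ℝ → ℝ} (hh : Measurable h)
    (hb : ∀ t ∈ Ioo (0 : ℝ) 1, |h t| ≤ 1)
    (hF : ∀ u ∈ Icc (0 : ℝ) 1, ∫ t in (0 : ℝ)..1, deriv (C u) t * h t = F u)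
    (hFi : IntervalIntegrable (fun t => deriv F t ^ 2) volume 0 1)
    (hFd : ∀ᵐ t, t ∈ Ioo (0 : ℝ) 1 → DifferentiableAt ℝ F t) :
    ∫ t in (0 : ℝ)..1, deriv F t ^ 2 ≤ ∫ t in (0 : ℝ)..1, h t ^ 2 := by
  set H : ℝ → ℝ := fun u => ∫ t in (0 : ℝ)..1, deriv (C u) t * h t ^ 2 with hH
  have hb2 (t : ℝ) (ht : t ∈ Ioo (0 : ℝ) 1) : h t ^ 2 ≤ 1 := by
    simpa using (sq_le_one_iff_abs_le_one _).2 (hb t ht)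
  have hd0 (u : ℝ) (hu : u ∈ Icc (0 : ℝ) 1) : IntervalIntegrable (deriv (C u)) volume 0 1 :=
    (hC.absolutelyContinuousOnInterval hu).intervalIntegrable_deriv
  have hd1 (u : ℝ) (hu : u ∈ Icc (0 : ℝ) 1) :
      IntervalIntegrable (fun t => deriv (C u) t * h t) volume 0 1 := by
    refine intervalIntegrable_zero_one_of_measurable_of_abs_le ((measurable_deriv _).mul hh) 1
      fun t ht => ?_
    rw [abs_mul, abs_of_nonneg (hC.deriv_nonneg hu ht)]
    exact mul_le_one₀ (hC.deriv_le_one hu ht) (abs_nonneg _) (hb t ht)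
  have hd2 (u : ℝ) (hu : u ∈ Icc (0 : ℝ) 1) :
      IntervalIntegrable (fun t => deriv (C u) t * h t ^ 2) volume 0 1 := by
    refine intervalIntegrable_zero_one_of_measurable_of_abs_le
      ((measurable_deriv _).mul (hh.pow_const 2)) 1 fun t ht => ?_
    rw [abs_of_nonneg (mul_nonneg (hC.deriv_nonneg hu ht) (sq_nonneg _))]
    exact mul_le_one₀ (hC.deriv_le_one hu ht) (sq_nonneg _) (hb2 t ht)
  have hsq : IntervalIntegrable (fun t => h t ^ 2) volume 0 1 := by
    refine intervalIntegrable_zero_one_of_measurable_of_abs_le (hh.pow_const 2) 1 fun t ht => ?_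
    rw [abs_of_nonneg (sq_nonneg _)]
    exact hb2 t ht
  have hexp (c u : ℝ) (hu : u ∈ Icc (0 : ℝ) 1) :
      IntervalIntegrable (fun t => deriv (C u) t * (h t - c) ^ 2) volume 0 1 ∧
      ∫ t in (0 : ℝ)..1, deriv (C u) t * (h t - c) ^ 2 = H u - 2 * c * F u + c ^ 2 * u := by
    have he : (fun t => deriv (C u) t * (h t - c) ^ 2) = fun t =>
        deriv (C u) t * h t ^ 2 - 2 * c * (deriv (C u) t * h t) + c ^ 2 * deriv (C u) t := by
      funext t; ring
    rw [he]
    refine ⟨((hd2 u hu).sub ((hd1 u hu).const_mul _)).add ((hd0 u hu).const_mul _), ?_⟩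
    rw [integral_add ((hd2 u hu).sub ((hd1 u hu).const_mul _)) ((hd0 u hu).const_mul _),
      integral_sub (hd2 u hu) ((hd1 u hu).const_mul _),
      intervalIntegral.integral_const_mul, intervalIntegral.integral_const_mul,
      hF u hu, hC.integral_deriv hu ⟨zero_le_one, le_rfl⟩, hC.one_right u hu]
  -- Jensen in integrated form: `∂₂C(u,t)` increases with `u` and is weighted by `(h - c)² ≥ 0`.
  have hmono (c : ℝ) : MonotoneOn (fun u => H u - 2 * c * F u + c ^ 2 * u) (Icc 0 1) := by
    intro u₁ hu₁ u₂ hu₂ hu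
    dsimp only
    rw [← (hexp c u₁ hu₁).2, ← (hexp c u₂ hu₂).2]
    refine integral_zero_one_mono_of_ae_Ioo (hexp c u₁ hu₁).1 (hexp c u₂ hu₂).1 ?_
    filter_upwards [hC.ae_deriv_le_deriv hu₁ hu₂ hu] with t ht ht'
    exact mul_le_mul_of_nonneg_right (ht ht') (sq_nonneg _)
  have hHm : MonotoneOn H (Icc 0 1) := by simpa using hmono 0
  -- Differentiate at `t` with the optimal `c = F'(t)`. It may vary with `t`, as the exceptional set
  -- depends only on `H` and `F`.
  have hle : ∀ᵐ t, t ∈ Ioo (0 : ℝ) 1 → deriv F t ^ 2 ≤ deriv H t := by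
    filter_upwards [hHm.ae_differentiableWithinAt_of_mem, hFd] with t hHt hFt ht
    have hHt' := (hHt (Ioo_subset_Icc_self ht)).differentiableAt (Icc_mem_nhds ht.1 ht.2)
    have hd := ((hHt'.hasDerivAt.sub ((hFt ht).hasDerivAt.const_mul (2 * deriv F t))).add
      ((hasDerivAt_id t).const_mul (deriv F t ^ 2))).deriv
    have hn : 0 ≤ deriv (fun u => H u - 2 * deriv F t * F u + deriv F t ^ 2 * u) t := by
      rw [← derivWithin_of_mem_nhds (Icc_mem_nhds ht.1 ht.2)]
      exact (hmono _).derivWithin_nonneg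
    have heq : deriv (fun u => H u - 2 * deriv F t * F u + deriv F t ^ 2 * u) t =
      deriv H t - 2 * deriv F t * deriv F t + deriv F t ^ 2 * 1 := hd
    rw [heq] at hn
    nlinarith
  have hHu : MonotoneOn H (uIcc 0 1) := by rwa [uIcc_of_le zero_le_one]
  have h01 : H 0 ≤ H 1 := hHm ⟨le_rfl, zero_le_one⟩ ⟨zero_le_one, le_rfl⟩ zero_le_one
  -- Monotonicity of `H` suffices for this inequality.
  have hHint : ∫ t in (0 : ℝ)..1, deriv H t ≤ H 1 - H 0 := by
    have := hHu.intervalIntegral_deriv_mem_uIcc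
    rw [uIcc_of_le (by linarith)] at this
    exact this.2
  have hH0 : 0 ≤ H 0 := by
    have := integral_zero_one_mono_of_ae_Ioo (f := fun _ => 0) (by simp)
      (hd2 0 ⟨le_rfl, zero_le_one⟩) (.of_forall fun t ht =>
        mul_nonneg (hC.deriv_nonneg ⟨le_rfl, zero_le_one⟩ ht) (sq_nonneg _))
    simpa using this
  have hH1 : H 1 ≤ ∫ t in (0 : ℝ)..1, h t ^ 2 :=
    integral_zero_one_mono_of_ae_Ioo (hd2 1 ⟨zero_le_one, le_rfl⟩) hsq (.of_forall fun t ht =>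
      mul_le_of_le_one_left (sq_nonneg _) (hC.deriv_le_one ⟨zero_le_one, le_rfl⟩ ht))
  linarith [integral_zero_one_mono_of_ae_Ioo hFi hHu.intervalIntegrable_deriv hle]

/-- For an idempotent copula the operator `1_[0,v] ↦ ∂₁C(·,v)` is a contractive projection, so that
`‖∂₁C(·,v)‖² ≤ ⟨∂₁C(·,v), 1_[0,v]⟩ = C(v,v)`. -/
theorem integral_sq_deriv_le_diag (hC : IsCopula C) (hI : IsMarkovIdempotent C) {v : ℝ}
    (hv : v ∈ Icc (0 : ℝ) 1) :
    ∫ t in (0 : ℝ)..1, deriv (fun s => C s v) t ^ 2 ≤ C v v := by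
  have hT := hC.transpose
  set F : ℝ → ℝ := fun s => C s v with hFdef
  have hFm : Measurable (deriv F) := measurable_deriv _
  have hF0 (t : ℝ) (ht : t ∈ Ioo (0 : ℝ) 1) : 0 ≤ deriv F t := hT.deriv_nonneg hv ht
  have hF1 (t : ℝ) (ht : t ∈ Ioo (0 : ℝ) 1) : deriv F t ≤ 1 := hT.deriv_le_one hv ht
  have hFsq : IntervalIntegrable (fun t => deriv F t ^ 2) volume 0 1 := by
    refine intervalIntegrable_zero_one_of_measurable_of_abs_le (hFm.pow_const 2) 1 fun t ht => ?_
    rw [abs_of_nonneg (sq_nonneg _)]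
    exact pow_le_one₀ (hF0 t ht) (hF1 t ht)
  have hind (f : ℝ → ℝ) : ∫ t in (0 : ℝ)..1, (Iic v).indicator f t = ∫ t in (0 : ℝ)..v, f t :=
    integral_indicator hv
  have hindi {f : ℝ → ℝ} (hf : IntervalIntegrable f volume 0 1) :
      IntervalIntegrable ((Iic v).indicator f) volume 0 1 :=
    ⟨hf.1.indicator measurableSet_Iic, hf.2.indicator measurableSet_Iic⟩
  have hFi : IntervalIntegrable (deriv F) volume 0 1 :=
    (hT.absolutelyContinuousOnInterval hv).intervalIntegrable_deriv
  -- The operator sends both `F'` and `1_[0,v]` to `F'`, hence also each point `h` of the segment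
  -- joining them; contractivity gives `‖F'‖² ≤ ‖h‖²`.
  have key (s : ℝ) (hs : s ∈ Ioc (0 : ℝ) 1) :
      ∫ t in (0 : ℝ)..1, deriv F t ^ 2 ≤
        (1 - s) ^ 2 * (∫ t in (0 : ℝ)..1, deriv F t ^ 2) + 2 * s * (1 - s) * C v v + s ^ 2 * v := by
    have hs0 : 0 ≤ s := hs.1.le
    have hs1 : 0 ≤ 1 - s := sub_nonneg.2 hs.2
    let h : ℝ → ℝ := fun t => (1 - s) * deriv F t + s * (Iic v).indicator (fun _ => 1) t
    have hhm : Measurable h :=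
      (hFm.const_mul _).add ((measurable_const.indicator measurableSet_Iic).const_mul _)
    have hle : ∫ t in (0 : ℝ)..1, deriv F t ^ 2 ≤ ∫ t in (0 : ℝ)..1, h t ^ 2 := by
      refine hC.integral_sq_deriv_le hhm (fun t ht => ?_) (fun u hu => ?_) hFsq ?_
      · have h0 : 0 ≤ (Iic v).indicator (fun _ => (1 : ℝ)) t :=
          indicator_nonneg (fun _ _ => zero_le_one) t
        have h1 : (Iic v).indicator (fun _ => (1 : ℝ)) t ≤ 1 :=
          indicator_le_self' (fun _ _ => zero_le_one) t
        rw [abs_of_nonneg (add_nonneg (mul_nonneg hs1 (hF0 t ht)) (mul_nonneg hs0 h0))]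
        nlinarith [mul_le_mul_of_nonneg_left (hF1 t ht) hs1, mul_le_mul_of_nonneg_left h1 hs0]
      · have he : (fun t => deriv (C u) t * h t) = fun t => (1 - s) * (deriv (C u) t * deriv F t) +
            s * (Iic v).indicator (deriv (C u)) t := by
          funext t
          by_cases ht : t ∈ Iic v <;> simp [h, ht] <;> ring
        have hi : IntervalIntegrable (fun t => deriv (C u) t * deriv F t) volume 0 1 := by
          refine intervalIntegrable_zero_one_of_measurable_of_abs_le
            ((measurable_deriv _).mul hFm) 1 fun t ht => ?_
          rw [abs_of_nonneg (mul_nonneg (hC.deriv_nonneg hu ht) (hF0 t ht))]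
          exact mul_le_one₀ (hC.deriv_le_one hu ht) (hF0 t ht) (hF1 t ht)
        have hid : ∫ t in (0 : ℝ)..1, deriv (C u) t * deriv F t = C u v := hI u hu v hv
        rw [he, integral_add (hi.const_mul _) ((hindi
          (hC.absolutelyContinuousOnInterval hu).intervalIntegrable_deriv).const_mul _),
          intervalIntegral.integral_const_mul, intervalIntegral.integral_const_mul, hind, hid,
            hC.integral_deriv hu hv]
        simp only [hFdef]
        ring
      · filter_upwards [(hT.absolutelyContinuousOnInterval hv).ae_differentiableAt] with t h₁ ht
        exact h₁ (by rw [uIcc_of_le zero_le_one]; exact Ioo_subset_Icc_self ht)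
    have he : (fun t => h t ^ 2) = fun t => (1 - s) ^ 2 * deriv F t ^ 2 +
        2 * s * (1 - s) * (Iic v).indicator (deriv F) t +
        s ^ 2 * (Iic v).indicator (fun _ => (1 : ℝ)) t := by
      funext t
      by_cases ht : t ∈ Iic v <;> simp [h, ht] <;> ring
    have hdiag : ∫ t in (0 : ℝ)..v, deriv F t = C v v := hT.integral_deriv hv hv
    have hone : IntervalIntegrable (fun _ : ℝ => (1 : ℝ)) volume 0 1 := by simp
    rw [he, integral_add ((hFsq.const_mul _).add ((hindi hFi).const_mul _))
      ((hindi hone).const_mul _), integral_add (hFsq.const_mul _) ((hindi hFi).const_mul _),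
      intervalIntegral.integral_const_mul, intervalIntegral.integral_const_mul,
      intervalIntegral.integral_const_mul, hind, hind, hdiag] at hle
    simpa using hle
  set G := ∫ t in (0 : ℝ)..1, deriv F t ^ 2
  have key' (s : ℝ) (hs : s ∈ Ioc (0 : ℝ) 1) :
      0 ≤ 2 * (C v v - G) + s * (G - 2 * C v v + v) := by
    have := key s hs
    refine nonneg_of_mul_nonneg_right (a := s) ?_ hs.1
    linarith
  -- This is the limit `s → 0`. If `C v v < G`, a small `s` makes the slope term at most `G - C v
  -- v`, too little to offset `2 * (C v v - G)`.
  by_contra! hlt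
  by_cases hK : G - 2 * C v v + v ≤ 0
  · linarith [key' 1 ⟨one_pos, le_rfl⟩]
  · push Not at hK
    have hs : 0 < min 1 ((G - C v v) / (G - 2 * C v v + v)) :=
      lt_min one_pos (div_pos (by linarith) hK)
    have h1 := key' _ ⟨hs, min_le_left _ _⟩
    have h2 := mul_le_mul_of_nonneg_right
      (min_le_right 1 ((G - C v v) / (G - 2 * C v v + v))) hK.le
    rw [div_mul_cancel₀ _ hK.ne'] at h2
    linarith

theorem eq_productCopula (hC : IsCopula C) (hI : IsMarkovIdempotent C)
    (hN : IsNegativeQuadrantDependent C) {u v : ℝ} (hu : u ∈ Icc (0 : ℝ) 1)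
    (hv : v ∈ Icc (0 : ℝ) 1) : C u v = productCopula u v := by
  have hT := hC.transpose
  have hG := hC.integral_sq_deriv_le_diag hI hv
  have hvv : C v v ≤ v * v := hN v hv v hv
  have hone : ∫ t in (0 : ℝ)..1, deriv (fun s => C s v) t = v := by
    rw [hT.integral_deriv hv ⟨zero_le_one, le_rfl⟩, hC.one_left v hv]
  have hu' : ∫ t in (0 : ℝ)..u, deriv (fun s => C s v) t = C u v := hT.integral_deriv hv hu
  have hm : Measurable (deriv fun s => C s v) := measurable_deriv _
  have hi : IntervalIntegrable (deriv fun s => C s v) volume 0 1 :=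
    (hT.absolutelyContinuousOnInterval hv).intervalIntegrable_deriv
  have hsq : IntervalIntegrable (fun t => deriv (fun s => C s v) t ^ 2) volume 0 1 := by
    refine intervalIntegrable_zero_one_of_measurable_of_abs_le (hm.pow_const 2) 1 fun t ht => ?_
    rw [abs_of_nonneg (sq_nonneg _)]
    exact pow_le_one₀ (hT.deriv_nonneg hv ht) (hT.deriv_le_one hv ht)
  set g := deriv fun s => C s v
  have he : (fun t => (g t - v) ^ 2) = fun t => g t ^ 2 - 2 * v * g t + v ^ 2 := by
    funext t; ring
  have hint : IntervalIntegrable (fun t => (g t - v) ^ 2) volume 0 1 := by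
    rw [he]
    exact (hsq.sub (hi.const_mul _)).add (by simp)
  -- As `g` has mean `v`, the integral is `‖g‖² - v²`, and `‖g‖² ≤ C v v ≤ v²`.
  have hle : ∫ t in (0 : ℝ)..1, (g t - v) ^ 2 ≤ 0 := by
    rw [he, integral_add (hsq.sub (hi.const_mul _)) (by simp), integral_sub hsq (hi.const_mul _),
      intervalIntegral.integral_const_mul, hone]
    simp only [intervalIntegral.integral_const, sub_zero, one_smul]
    nlinarith
  have hzero : ∫ t in (0 : ℝ)..1, (g t - v) ^ 2 = 0 :=
    hle.antisymm (integral_nonneg zero_le_one fun t _ => sq_nonneg _)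
  rw [integral_eq_zero_iff_of_le_of_nonneg_ae zero_le_one
    (.of_forall fun t => sq_nonneg _) hint, Filter.EventuallyEq,
    ae_restrict_iff' measurableSet_Ioc] at hzero
  have hcongr : ∫ t in (0 : ℝ)..u, g t = ∫ _ in (0 : ℝ)..u, v := by
    apply intervalIntegral.integral_congr_ae
    filter_upwards [hzero] with t ht htu
    rw [uIoc_of_le hu.1] at htu
    exact sub_eq_zero.1 (pow_eq_zero_iff two_ne_zero |>.1 (ht ⟨htu.1, htu.2.trans hu.2⟩))
  rw [← hu', hcongr]
  simp [productCopula]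

end IsCopula

/-! ### The product copula -/

theorem isCopula_productCopula : IsCopula productCopula where
  zero_left v _ := by simp [productCopula]
  zero_right u _ := by simp [productCopula]
  one_left v _ := by simp [productCopula]
  one_right u _ := by simp [productCopula]
  two_increasing u₁ _ u₂ _ v₁ _ v₂ _ hu hv := by
    simp only [productCopula]
    nlinarith [mul_nonneg (sub_nonneg.2 hu) (sub_nonneg.2 hv)]

theorem isMarkovIdempotent_productCopula : IsMarkovIdempotent productCopula := by
  intro u _ v _
  have h₁ (t : ℝ) : deriv (fun s => u * s) t = u := by
    simp
  have h₂ (t : ℝ) : deriv (fun s => s * v) t = v := by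
    simp
  simp [markovProduct, productCopula, h₁, h₂]

theorem mainTheorem6 :
    (IsCopula productCopula ∧ IsMarkovIdempotent productCopula ∧
      IsNegativeQuadrantDependent productCopula) ∧
    ∀ C : ℝ → ℝ → ℝ, IsCopula C → IsMarkovIdempotent C → IsNegativeQuadrantDependent C →
      ∀ u ∈ Icc (0 : ℝ) 1, ∀ v ∈ Icc (0 : ℝ) 1, C u v = productCopula u v := by
  exact ⟨⟨isCopula_productCopula, isMarkovIdempotent_productCopula, fun _ _ _ _ => le_rfl⟩,
    fun _ hC hI hN _ hu _ hv => hC.eq_productCopula hI hN hu hv⟩
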